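/- Let $(S,+)$ be a commutative semigroup with neutral element $0$ (no topology, cancellativity not assumed), let $E$ be a complex Banach space, and let $\mathscr{L}(E)$ be the Banach algebra of bounded linear operators on $E$. Let $T\colon S\to\mathscr{L}(E)$ be a bounded representation, i.e. $T_0=\mathrm{Id}_E$, $T_{s+t}=T_sT_t$ for all $s,t\in S$, and $\sup_{s\in S}\|T_s\|<\infty$. Then the following are equivalent: (a) $T$ is quasi-compact, i.e. there exist $s\in S$ and a compact operator $K\in\mathscr{L}(E)$ with $\|T_s-K\|<1$. (b) Every $\chi\in\sigma_{\mathrm{uni}}(T)$ is a Riesz point of $T$. Here a unitary character of $S$ is a map $\chi\colon S\to\{z\in\mathbb{C}:|z|=1\}$ with $\chi(0)=1$ and $\chi(s+t)=\chi(s)\chi(t)$ for all $s,t\in S$. For a bounded representation $R\colon S\to\mathscr{L}(F)$ on a Banach space $F$, the unitary spectrum $\sigma_{\mathrm{uni}}(R)$ is the set of all unitary characters $\chi$ for which there is a net $(c_j)$ in $\mathscr{L}(F)$ with $\|c_j\|=1$ for all $j$ and $\|(\chi(s)\,\mathrm{Id}_F-R_s)c_j\|\to 0$ for every $s\in S$.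 The eigenspace of a unitary character $\chi$ is $\ker(\chi-T)=\{x\in E: T_sx=\chi(s)x\text{ for all }s\in S\}$. The character $\chi$ is a pole of $T$ if there is a projection $P=P^2\in\mathscr{L}(E)$ with range $\ker(\chi-T)$ such that $PT_s=T_sP$ for all $s\in S$ and $\chi\notin\sigma_{\mathrm{uni}}(T|_{\ker P})$, where $T|_{\ker P}$ denotes the representation $s\mapsto T_s|_{\ker P}$ on the closed invariant subspace $\ker P$. It is a Riesz point of $T$ if it is a pole of $T$ and $\dim\ker(\chi-T)<\infty$. -/

import Mathlib

namespace SemigroupRep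

open Filter Topology

/-- A representation of the commutative monoid `(S, +)` in the unital algebra `A`: a map with
`T 0 = 1` and `T (s + t) = T s * T t`. This is Mathlib's `AddChar S A`. -/
abbrev Representation (S A : Type*) [AddCommMonoid S] [Monoid A] := AddChar S A

/-- The unitary dual of `S`: monoid homomorphisms from `(S, +)` to the complex unit circle. -/
abbrev UnitaryDual (S : Type*) [AddCommMonoid S] := AddChar S Circle

/-- `T` is bounded: `sup_s ‖T s‖ < ∞`. -/
def IsBounded {S A : Type*} [AddCommMonoid S] [NormedRing A]
    (T : Representation S A) : Prop :=
  ∃ M : ℝ, ∀ s : S, ‖T s‖ ≤ M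

/-- The unitary spectrum of a (bounded) representation in a unital Banach algebra `A`: all unitary
characters `χ` for which there is a net of elements `c` of norm one in `A` such that
`(χ(s) - T s) c → 0` for every `s`. The net is expressed by a proper filter on `A`. -/
def unitarySpectrum {S A : Type*} [AddCommMonoid S] [NormedRing A] [NormedAlgebra ℂ A]
    (T : Representation S A) : Set (UnitaryDual S) :=
  {χ | ∃ l : Filter A, l.NeBot ∧ (∀ᶠ c in l, ‖c‖ = 1) ∧
    ∀ s : S, Tendsto (fun c : A => (algebraMap ℂ A (χ s : ℂ) - T s) * c) l (𝓝 0)}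

section Operators

variable {S E : Type*} [AddCommMonoid S] [NormedAddCommGroup E] [NormedSpace ℂ E]

/-- The eigenspace `ker (χ - T)`: all `x` with `T s x = χ(s) x` for every `s`. -/
def eigenspace (T : Representation S (E →L[ℂ] E)) (χ : UnitaryDual S) : Submodule ℂ E where
  carrier := {x | ∀ s : S, T s x = (χ s : ℂ) • x}
  add_mem' := by
    intro x y hx hy s
    rw [map_add, hx s, hy s, smul_add]
  zero_mem' := by
    intro s
    rw [map_zero, smul_zero]
  smul_mem' := by
    intro c x hx s
    rw [map_smul, hx s, smul_comm]

/-- The restriction of a representation to an invariant subspace `F`. -/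
def restrict (T : Representation S (E →L[ℂ] E)) (F : Submodule ℂ E)
    (hF : ∀ s : S, ∀ x ∈ F, T s x ∈ F) : Representation S (F →L[ℂ] F) where
  toFun s := ((T s).comp F.subtypeL).codRestrict F (fun x => hF s x x.2)
  map_zero_eq_one' := by
    ext x
    simp
  map_add_eq_mul' := by
    intro s t
    ext x
    change T (s + t) (x : E) = T s (T t (x : E))
    rw [AddChar.map_add_eq_mul]
    rfl

/-- The kernel of an operator that commutes with all `T s` is invariant. -/
theorem ker_invariant (T : Representation S (E →L[ℂ] E)) (P : E →L[ℂ] E)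
    (hP : ∀ s : S, P * T s = T s * P) :
    ∀ s : S, ∀ x ∈ LinearMap.ker P.toLinearMap, T s x ∈ LinearMap.ker P.toLinearMap := by
  intro s x hx
  have hx' : P x = 0 := hx
  have h : P (T s x) = T s (P x) := congrArg (fun R : E →L[ℂ] E => R x) (hP s)
  change P (T s x) = 0
  rw [h, hx', map_zero]

/-- `χ` is a pole of `T`: there is a bounded projection `P` onto `ker (χ - T)` that commutes with
all `T s` and such that `χ` is not in the unitary spectrum of the restriction of `T` to `ker P`. -/
def IsPole (T : Representation S (E →L[ℂ] E)) (χ : UnitaryDual S) : Prop :=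
  ∃ (P : E →L[ℂ] E) (hP : ∀ s : S, P * T s = T s * P),
    P * P = P ∧ LinearMap.range P.toLinearMap = eigenspace T χ ∧
    χ ∉ unitarySpectrum
      (A := LinearMap.ker P.toLinearMap →L[ℂ] LinearMap.ker P.toLinearMap)
      (restrict T (LinearMap.ker P.toLinearMap) (ker_invariant T P hP))

/-- `χ` is a Riesz point of `T`: a pole with finite-dimensional eigenspace. -/
def IsRieszPoint (T : Representation S (E →L[ℂ] E)) (χ : UnitaryDual S) : Prop :=
  IsPole T χ ∧ FiniteDimensional ℂ (eigenspace T χ)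

/-- `T` is quasi-compact: `‖T s - K‖ < 1` for some `s` and some compact operator `K`. -/
def IsQuasiCompact (T : Representation S (E →L[ℂ] E)) : Prop :=
  ∃ (s : S) (K : E →L[ℂ] E), IsCompactOperator K ∧ ‖T s - K‖ < 1

end Operators

end SemigroupRep

/-! If `T` is quasi-compact, one operator `T a` is within distance less than 1 of a compact one, so
bounded approximate `χ`-eigenvectors converge along ultrafilters
(`exists_tendsto_of_approx_eigenvectors`). This makes the unit ball of the eigenspace compact.
Applied to products of Cesàro means of `χ⁻¹ T` (`exists_approx_mean`), it yields a mean ergodic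
projection `P` onto the eigenspace. Approximate eigenvectors in `ker P` would have a limit that is
both a unit eigenvector and killed by `P`. So every character is a Riesz point.

Conversely, poles are isolated and the unitary dual is compact, so the unitary spectrum is finite
and the sum `P₀` of the spectral projections has finite rank. If `T` were not quasi-compact, `‖T s
(1 - P₀)‖ ≥ 1` for all `s`. The orbit of `1 - P₀` under left multiplication then stays away from
zero, and `exists_isApproxEigenvalueOn` produces a spectral character living on `ker P₀`, which
contradicts the pole property there.

That existence result replaces spectral theory of commutative Banach algebras by an elementary
argument: `T` is isometric for an asymptotic seminorm, a single isometry has approximate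
eigenvectors given by explicit polynomials, and these combine over finite sets and pass to a limit
character. -/

namespace SemigroupRep
open Filter Topology

/-! ### Approximate eigenvalues of one seminorm isometry. -/

section Isometry

variable {X : Type*} [AddCommGroup X] [Module ℂ X]

theorem sum_pow_primitiveRoot {n : ℕ} {ζ : ℂ} (hζ : IsPrimitiveRoot ζ n) (e : ℕ) :
    ∑ m ∈ Finset.range n, (ζ ^ m) ^ e = if n ∣ e then (n : ℂ) else 0 := by
  have h1 : ∑ m ∈ Finset.range n, (ζ ^ m) ^ e = ∑ m ∈ Finset.range n, (ζ ^ e) ^ m :=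
    Finset.sum_congr rfl fun m _ => by rw [← pow_mul, ← pow_mul, mul_comm]
  rw [h1]
  split_ifs with h
  · rw [(hζ.pow_eq_one_iff_dvd e).2 h]; simp
  · have h2 : ζ ^ e ≠ 1 := fun h3 => h ((hζ.pow_eq_one_iff_dvd e).1 h3)
    rw [geom_sum_eq h2, ← pow_mul, mul_comm, pow_mul, hζ.pow_eq_one, one_pow, sub_self, zero_div]

/-- Averaging squared Dirichlet kernels over the roots of unity isolates the middle coefficient. -/
theorem sum_sq_geom_sum (U : Module.End ℂ X) {M : ℕ} (hM : 0 < M) {ζ : ℂ}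
    (hζ : IsPrimitiveRoot ζ (2 * M)) :
    ∑ m ∈ Finset.range (2 * M), ((ζ ^ m) ^ (M + 1)) •
      (∑ i ∈ Finset.range M, ((ζ ^ m) • U) ^ i) ^ 2 = ((2 * M : ℂ) * M) • U ^ (M - 1) := by
  have h1 : ∀ m, ((ζ ^ m) ^ (M + 1)) • (∑ i ∈ Finset.range M, ((ζ ^ m) • U) ^ i) ^ 2 =
      ∑ i ∈ Finset.range M, ∑ j ∈ Finset.range M,
        ((ζ ^ m) ^ (M + 1 + i + j)) • U ^ (i + j) := by
    intro m
    rw [sq, Finset.sum_mul_sum, Finset.smul_sum]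
    refine Finset.sum_congr rfl fun i _ => ?_
    rw [Finset.smul_sum]
    refine Finset.sum_congr rfl fun j _ => ?_
    rw [smul_pow, smul_pow, smul_mul_smul_comm, smul_smul, ← pow_add U, pow_add _ (M + 1 + i),
      pow_add _ (M + 1), mul_assoc]
  simp_rw [h1]
  rw [Finset.sum_comm]
  have h2 : ∀ i ∈ Finset.range M, ∑ m ∈ Finset.range (2 * M), ∑ j ∈ Finset.range M,
      ((ζ ^ m) ^ (M + 1 + i + j)) • U ^ (i + j) = (2 * M : ℂ) • U ^ (M - 1) := by
    intro i hi
    have hi' := Finset.mem_range.1 hi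
    rw [Finset.sum_comm]
    simp_rw [← Finset.sum_smul]
    -- The exponent `M + 1 + i + j` lies between `M + 1` and `3M - 1`, so it is a multiple of `2M`
    -- only when `i + j = M - 1`.
    rw [Finset.sum_eq_single (M - 1 - i)]
    · rw [sum_pow_primitiveRoot hζ, if_pos, show i + (M - 1 - i) = M - 1 by omega]
      · push_cast; rfl
      · exact ⟨1, by omega⟩
    · intro j hj hne
      have hj' := Finset.mem_range.1 hj
      rw [sum_pow_primitiveRoot hζ, if_neg, zero_smul]
      rintro ⟨k, hk⟩
      have : k = 1 := by
        have : k < 2 := by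
          by_contra h
          have : 2 * M * 2 ≤ 2 * M * k := Nat.mul_le_mul_left _ (by omega)
          omega
        have : k ≠ 0 := by rintro rfl; omega
        omega
      subst this; omega
    · intro h; exact absurd (Finset.mem_range.2 (by omega)) h
  rw [Finset.sum_congr rfl h2, Finset.sum_const, Finset.card_range, ← Nat.cast_smul_eq_nsmul ℂ,
    smul_smul, mul_comm]

theorem seminorm_sum_le (p : Seminorm ℂ X) {ι : Type*} (s : Finset ι) (f : ι → X) :
    p (∑ i ∈ s, f i) ≤ ∑ i ∈ s, p (f i) :=
  Finset.le_sum_of_subadditive p (map_zero p).le (map_add_le_add p) s f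

theorem seminorm_pow_apply (p : Seminorm ℂ X) {V : Module.End ℂ X} (hV : ∀ x, p (V x) = p x)
    (n : ℕ) (x : X) : p ((V ^ n) x) = p x := by
  induction n with
  | zero => simp
  | succ n ih => rw [pow_succ', Module.End.mul_apply, hV, ih]

theorem seminorm_geom_sum_le (p : Seminorm ℂ X) {V : Module.End ℂ X} (hV : ∀ x, p (V x) = p x)
    (M : ℕ) (x : X) : p ((∑ i ∈ Finset.range M, V ^ i) x) ≤ M * p x := by
  rw [LinearMap.sum_apply]
  refine (seminorm_sum_le p _ _).trans ?_
  simp [seminorm_pow_apply p hV]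

theorem seminorm_one_sub_le (p : Seminorm ℂ X) {V : Module.End ℂ X} (hV : ∀ x, p (V x) = p x)
    (x : X) : p ((1 - V) x) ≤ 2 * p x := by
  rw [LinearMap.sub_apply, Module.End.one_apply]
  refine (map_sub_le_add p _ _).trans ?_
  rw [hV, two_mul]

/-- Every isometry of a seminorm has unimodular approximate eigenvalues on every cyclic subspace,
and the approximate eigenvector is obtained by a polynomial in the isometry that is bounded from
above and, at the given vector, from below by constants that depend only on the precision. -/
theorem exists_approx_eigenvalue_of_isometry (p : Seminorm ℂ X) (U : Module.End ℂ X)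
    (hU : ∀ x, p (U x) = p x) {ε : ℝ} (hε : 0 < ε) :
    ∃ c C : ℝ, 0 < c ∧ 0 < C ∧ ∀ x : X, ∃ (z : Circle) (Q : Module.End ℂ X),
      Q ∈ Algebra.adjoin ℂ {U} ∧ (∀ y, p (Q y) ≤ C * p y) ∧ c * p x ≤ p (Q x) ∧
      p (U (Q x) - (z : ℂ) • Q x) ≤ ε * p (Q x) := by
  obtain ⟨M, hM⟩ := exists_nat_gt (max 1 (4 / (ε * ε)))
  have hM1 : (1 : ℝ) < M := (le_max_left _ _).trans_lt hM
  have hM0 : 0 < M := by exact_mod_cast (zero_lt_one.trans hM1)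
  have hM4 : 4 ≤ ε * ε * M := by
    have := (le_max_right _ _).trans_lt hM
    rw [div_lt_iff₀ (by positivity)] at this
    linarith
  refine ⟨min 1 ε * M, 2 * (M * M), by positivity, by positivity, fun x => ?_⟩
  have hζ := Complex.isPrimitiveRoot_exp (2 * M) (by omega)
  set ζ := Complex.exp (2 * Real.pi * Complex.I / (2 * M : ℕ)) with hζdef
  have hζn : ‖ζ‖ = 1 := hζ.norm'_eq_one (by omega)
  set D : ℕ → Module.End ℂ X := fun m => ∑ i ∈ Finset.range M, ((ζ ^ m) • U) ^ i with hD
  -- By `sum_sq_geom_sum` and isometry, the `2M` values `p ((D m ^ 2) x)` add up to at least `2M * M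
  -- * p x`, so one of them reaches the average.
  obtain ⟨m, hm⟩ : ∃ m, (M : ℝ) * p x ≤ p ((D m ^ 2) x) := by
    by_contra! hcon
    have h1 := congrArg (fun R : Module.End ℂ X => p (R x)) (sum_sq_geom_sum U hM0 hζ)
    simp only [LinearMap.sum_apply, LinearMap.smul_apply, map_smul_eq_mul,
      seminorm_pow_apply p hU] at h1
    have h2 : p (∑ m ∈ Finset.range (2 * M), ((ζ ^ m) ^ (M + 1)) • ((D m ^ 2) x)) <
        ∑ m ∈ Finset.range (2 * M), (M : ℝ) * p x := by
      refine (seminorm_sum_le p _ _).trans_lt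
        (Finset.sum_lt_sum_of_nonempty ⟨0, Finset.mem_range.2 (by omega)⟩ fun m _ => ?_)
      rw [map_smul_eq_mul, norm_pow, norm_pow, hζn]
      simpa using hcon m
    simp only [hD] at h2
    rw [h1, Finset.sum_const, Finset.card_range] at h2
    simp at h2
    linarith
  set V : Module.End ℂ X := (ζ ^ m) • U with hVdef
  have hzn : ‖ζ ^ m‖ = 1 := by rw [norm_pow, hζn, one_pow]
  have hz0 : ζ ^ m ≠ 0 := fun h => by rw [h] at hzn; simp at hzn
  have hV : ∀ y, p (V y) = p y := fun y => by
    rw [hVdef, LinearMap.smul_apply, map_smul_eq_mul, hzn, one_mul, hU]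
  have hDm : D m = ∑ i ∈ Finset.range M, V ^ i := rfl
  have hUA : U ∈ Algebra.adjoin ℂ {U} := Algebra.subset_adjoin rfl
  have hVA : V ∈ Algebra.adjoin ℂ {U} := Subalgebra.smul_mem _ hUA _
  have hDA : D m ∈ Algebra.adjoin ℂ {U} := by
    rw [hDm]; exact Subalgebra.sum_mem _ fun i _ => Subalgebra.pow_mem _ hVA i
  have hDle : ∀ y, p ((D m ^ 2) y) ≤ (M * M) * p y := fun y => by
    rw [sq, Module.End.mul_apply, hDm]
    refine (seminorm_geom_sum_le p hV M _).trans ?_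
    rw [mul_assoc]
    exact mul_le_mul_of_nonneg_left (seminorm_geom_sum_le p hV M _) (by positivity)
  let z : Circle := ⟨(ζ ^ m)⁻¹, mem_sphere_zero_iff_norm.2 (by rw [norm_inv, hzn, inv_one])⟩
  have hz : ∀ y, p (U y - (z : ℂ) • y) = p ((1 - V) y) := fun y => by
    have : U y - (z : ℂ) • y = (-(ζ ^ m)⁻¹) • ((1 - V) y) := by
      change U y - (ζ ^ m)⁻¹ • y = _
      rw [LinearMap.sub_apply, Module.End.one_apply, hVdef, LinearMap.smul_apply, smul_sub,
        smul_smul, neg_mul, inv_mul_cancel₀ hz0, neg_smul, neg_smul, one_smul]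
      abel
    rw [this, map_smul_eq_mul, norm_neg, norm_inv, hzn, inv_one, one_mul]
  have hpx : 0 ≤ p x := apply_nonneg p x
  have hmin1 : min 1 ε * M * p x ≤ M * p x := by
    rw [mul_assoc]
    exact mul_le_of_le_one_left (by positivity) (min_le_left _ _)
  -- Either `D² x` already works, or `(1 - V) D² x` is large compared with `D² x`. In the second
  -- case it works itself: `(1 - V) D = 1 - V ^ M` telescopes, so another factor `1 - V` gives `(1 -
  -- V ^ M)² x`, of size at most `4 p x`, which the choice of `M` makes small.
  by_cases hcase : p ((1 - V) ((D m ^ 2) x)) ≤ ε * p ((D m ^ 2) x)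
  · refine ⟨z, D m ^ 2, Subalgebra.pow_mem _ hDA 2, fun y => (hDle y).trans ?_,
      hmin1.trans hm, (hz _).trans_le hcase⟩
    have : 0 ≤ p y := apply_nonneg p y
    exact mul_le_mul_of_nonneg_right (by nlinarith) this
  · push Not at hcase
    refine ⟨z, (1 - V) * D m ^ 2, Subalgebra.mul_mem _ (Subalgebra.sub_mem _
      (Subalgebra.one_mem _) hVA) (Subalgebra.pow_mem _ hDA 2), fun y => ?_, ?_, ?_⟩
    · rw [Module.End.mul_apply]
      refine (seminorm_one_sub_le p hV _).trans ?_
      rw [mul_assoc]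
      exact mul_le_mul_of_nonneg_left (hDle y) (by norm_num)
    · rw [Module.End.mul_apply]
      refine le_trans ?_ hcase.le
      rw [mul_assoc]
      exact mul_le_mul (min_le_right _ _) hm (by positivity) hε.le
    · rw [hz, Module.End.mul_apply]
      have h1 : (1 - V) ((1 - V) ((D m ^ 2) x)) = (1 - V ^ M) ((1 - V ^ M) x) := by
        have : (1 - V) * ((1 - V) * D m ^ 2) = (1 - V ^ M) * (1 - V ^ M) := by
          have h2 : (1 - V) * D m = 1 - V ^ M := by rw [hDm]; exact mul_neg_geom_sum V M
          have h3 : Commute (1 - V) (D m) := by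
            rw [hDm]
            exact Commute.sum_right _ _ _ fun i _ =>
              ((Commute.one_left V).sub_left (Commute.refl V)).pow_right i
          rw [← h2, ← sq ((1 - V) * D m), h3.mul_pow 2, sq (1 - V), mul_assoc]
        exact congrArg (fun R : Module.End ℂ X => R x) this
      rw [h1]
      have hVM := seminorm_pow_apply p hV M
      have h4 : p ((1 - V ^ M) ((1 - V ^ M) x)) ≤ 2 * (2 * p x) :=
        (seminorm_one_sub_le p hVM _).trans
          (mul_le_mul_of_nonneg_left (seminorm_one_sub_le p hVM _) (by norm_num))
      calc _ ≤ 2 * (2 * p x) := h4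
        _ = 4 * p x := by ring
        _ ≤ (ε * ε * M) * p x := mul_le_mul_of_nonneg_right hM4 hpx
        _ = ε * (ε * (M * p x)) := by ring
        _ ≤ ε * (ε * p ((D m ^ 2) x)) := by gcongr
        _ ≤ _ := by gcongr

end Isometry

/-! ### Joint approximate eigenvalues of commuting isometries. -/

section Family

variable {S X : Type*} [AddCommMonoid S] [AddCommGroup X] [Module ℂ X]

theorem commute_of_mem_adjoin_singleton {A : Type*} [Semiring A] [Algebra ℂ A] {a b q : A}
    (hab : Commute a b) (hq : q ∈ Algebra.adjoin ℂ {a}) : Commute q b := by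
  induction hq using Algebra.adjoin_induction with
  | mem x hx => rw [Set.mem_singleton_iff.1 hx]; exact hab
  | algebraMap r => exact Algebra.commute_algebraMap_left r b
  | add x y _ _ hx hy => exact hx.add_left hy
  | mul x y _ _ hx hy => exact hx.mul_left hy

theorem mem_of_mem_adjoin_singleton {W : Submodule ℂ X} {U Q : Module.End ℂ X}
    (hU : ∀ x ∈ W, U x ∈ W) (hQ : Q ∈ Algebra.adjoin ℂ {U}) : ∀ x ∈ W, Q x ∈ W := by
  induction hQ using Algebra.adjoin_induction with
  | mem V hV => rw [Set.mem_singleton_iff.1 hV]; exact hU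
  | algebraMap r => exact fun x hx => W.smul_mem r hx
  | add P Q _ _ hP hQ => exact fun x hx => W.add_mem (hP x hx) (hQ x hx)
  | mul P Q _ _ hP hQ => exact fun x hx => hP _ (hQ x hx)

/-- Adding one element `a` to `F` replaces `y` by `Q y` with `Q` a polynomial in `U a`. Such a `Q`
commutes with all `U s`, so the earlier approximate equations survive with a loss `C / c` that does
not depend on `y`. -/
theorem exists_joint_approx_eigenvalue (p : Seminorm ℂ X) (U : AddChar S (Module.End ℂ X))
    (hU : ∀ s x, p (U s x) = p x) (W : Submodule ℂ X) (hW : ∀ s, ∀ x ∈ W, U s x ∈ W)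
    {x : X} (hxW : x ∈ W) (hx : 0 < p x) (F : Finset S) :
    ∀ ε : ℝ, 0 < ε → ∃ (z : S → Circle) (y : X), y ∈ W ∧ 0 < p y ∧
      ∀ s ∈ F, p (U s y - (z s : ℂ) • y) ≤ ε * p y := by
  classical
  induction F using Finset.induction_on with
  | empty => exact fun ε _ => ⟨fun _ => 1, x, hxW, hx, fun s hs => absurd hs (Finset.notMem_empty s)⟩
  | insert a F ha ih =>
    intro ε hε
    obtain ⟨c, C, hc, hC, hQ⟩ := exists_approx_eigenvalue_of_isometry p (U a) (hU a) hε
    -- The constants `c`, `C` are known before `y` is chosen, so their loss can be compensated in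
    -- advance.
    obtain ⟨z, y, hyW, hy, hzy⟩ := ih (ε * c / C) (by positivity)
    obtain ⟨w, Q, hQA, hQC, hQc, hQw⟩ := hQ y
    refine ⟨Function.update z a w, Q y, mem_of_mem_adjoin_singleton (hW a) hQA y hyW,
      (mul_pos hc hy).trans_le hQc, fun s hs => ?_⟩
    rcases Finset.mem_insert.1 hs with rfl | hsF
    · simpa using hQw
    · rw [Function.update_of_ne (ne_of_mem_of_not_mem hsF ha)]
      have hcomm : Commute Q (U s) := commute_of_mem_adjoin_singleton
        (by rw [Commute, SemiconjBy, ← U.map_add_eq_mul, ← U.map_add_eq_mul, add_comm]) hQA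
      have h1 : U s (Q y) - (z s : ℂ) • Q y = Q (U s y - (z s : ℂ) • y) := by
        rw [map_sub, map_smul]
        exact congrArg (fun R : Module.End ℂ X => R y - (z s : ℂ) • Q y) hcomm.eq.symm
      rw [h1]
      calc _ ≤ C * p (U s y - (z s : ℂ) • y) := hQC _
        _ ≤ C * (ε * c / C * p y) := by gcongr; exact hzy s hsF
        _ = ε * (c * p y) := by field_simp
        _ ≤ _ := by gcongr

/-- Compactness of the circle gives pointwise limits of the approximate eigenvalues along an
ultrafilter on pairs (finite set, precision). Multiplicativity of the limit is tested on approximate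
eigenvectors for `{s, t, s + t}`. -/
theorem exists_unitary_character_of_isometries (p : Seminorm ℂ X)
    (U : AddChar S (Module.End ℂ X))
    (hU : ∀ s x, p (U s x) = p x) (W : Submodule ℂ X) (hW : ∀ s, ∀ x ∈ W, U s x ∈ W)
    {x : X} (hxW : x ∈ W) (hx : 0 < p x) :
    ∃ χ : UnitaryDual S, ∀ (F : Finset S) (ε : ℝ), 0 < ε → ∃ y ∈ W, 0 < p y ∧
      ∀ s ∈ F, p (U s y - (χ s : ℂ) • y) ≤ ε * p y := by
  have h : ∀ i : Finset S × ℕ, ∃ (z : S → Circle) (y : X), y ∈ W ∧ 0 < p y ∧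
      ∀ s ∈ i.1, p (U s y - (z s : ℂ) • y) ≤ (1 / ((i.2 : ℝ) + 1)) * p y := fun i =>
    exists_joint_approx_eigenvalue p U hU W hW hxW hx i.1 _ (by positivity)
  choose z y hyW hy hzy using h
  classical
  let 𝒰 : Ultrafilter (Finset S × ℕ) := Ultrafilter.of atTop
  have hlim : ∀ s, ∃ w : Circle, Tendsto (fun i => z i s) 𝒰 (𝓝 w) := fun s => by
    obtain ⟨w, -, hw⟩ := isCompact_univ.ultrafilter_le_nhds (𝒰.map fun i => z i s) (by simp)
    exact ⟨w, hw⟩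
  choose w hw using hlim
  have happ : ∀ (F : Finset S) (ε : ℝ), 0 < ε → ∃ y ∈ W, 0 < p y ∧
      ∀ s ∈ F, p (U s y - (w s : ℂ) • y) ≤ ε * p y := by
    intro F ε hε
    have h1 : ∀ᶠ i in (𝒰 : Filter (Finset S × ℕ)), ∀ s ∈ F, ‖(z i s : ℂ) - w s‖ < ε / 2 := by
      rw [Filter.eventually_all_finset]
      intro s _
      have : Tendsto (fun i => (z i s : ℂ)) 𝒰 (𝓝 (w s : ℂ)) :=
        (continuous_induced_dom.tendsto _).comp (hw s)
      filter_upwards [Metric.tendsto_nhds.1 this (ε / 2) (by positivity)] with i hi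
      rwa [dist_eq_norm] at hi
    obtain ⟨n, hn⟩ := exists_nat_one_div_lt (half_pos hε)
    have h2 : ∀ᶠ i in (𝒰 : Filter (Finset S × ℕ)), (F, n) ≤ i :=
      Ultrafilter.of_le atTop (eventually_ge_atTop _)
    obtain ⟨i, hi1, hi2⟩ := (h1.and h2).exists
    refine ⟨y i, hyW i, hy i, fun s hs => ?_⟩
    have h3 : U s (y i) - (w s : ℂ) • y i =
        (U s (y i) - (z i s : ℂ) • y i) + ((z i s : ℂ) - w s) • y i := by
      rw [sub_smul]; abel
    rw [h3]
    refine (map_add_le_add p _ _).trans ?_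
    rw [map_smul_eq_mul]
    have h4 : 1 / ((i.2 : ℝ) + 1) ≤ ε / 2 :=
      le_trans (one_div_le_one_div_of_le (by positivity) (by have := hi2.2; gcongr)) hn.le
    have h5 := hzy i s (hi2.1 hs)
    have h6 := mul_le_mul_of_nonneg_right h4 (hy i).le
    have h7 := mul_le_mul_of_nonneg_right (hi1 s hs).le (hy i).le
    linarith
  have heq : ∀ {a b : ℂ}, (∀ ε : ℝ, 0 < ε → ∃ y, 0 < p y ∧ p (a • y - b • y) ≤ ε * p y) → a = b := by
    intro a b hab
    rw [← sub_eq_zero, ← norm_le_zero_iff]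
    refine le_of_forall_pos_le_add fun ε hε => ?_
    obtain ⟨y, hy, h⟩ := hab ε hε
    rw [← sub_smul, map_smul_eq_mul] at h
    linarith [le_of_mul_le_mul_right h hy]
  refine ⟨{ toFun := w, map_zero_eq_one' := ?_, map_add_eq_mul' := fun s t => ?_ }, happ⟩
  · refine Subtype.ext (heq fun ε hε => ?_)
    obtain ⟨y, -, hy, h⟩ := happ {0} ε hε
    refine ⟨y, hy, ?_⟩
    have := h 0 (Finset.mem_singleton_self 0)
    rw [U.map_zero_eq_one, Module.End.one_apply] at this
    rw [map_sub_rev]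
    simpa using this
  · refine Subtype.ext (heq fun ε hε => ?_)
    obtain ⟨y, -, hy, h⟩ := happ {s, t, s + t} (ε / 3) (by positivity)
    refine ⟨y, hy, ?_⟩
    have h1 := h s (by simp)
    have h2 := h t (by simp)
    have h3 := h (s + t) (by simp)
    have h4 : ((w (s + t) : Circle) : ℂ) • y - (w s * w t : Circle) • y =
        (U s (U t y - (w t : ℂ) • y) + (w t : ℂ) • (U s y - (w s : ℂ) • y)) -
          (U (s + t) y - (w (s + t) : ℂ) • y) := by
      rw [U.map_add_eq_mul, Module.End.mul_apply, map_sub, map_smul, smul_sub, smul_smul,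
        mul_comm (w t : ℂ)]
      change _ - ((w s : ℂ) * (w t : ℂ)) • y = _
      abel
    change p (((w (s + t) : Circle) : ℂ) • y - (w s * w t : Circle) • y) ≤ _
    rw [h4]
    refine (map_sub_le_add p _ _).trans ?_
    have h5 := map_add_le_add p (U s (U t y - (w t : ℂ) • y)) ((w t : ℂ) • (U s y - (w s : ℂ) • y))
    rw [hU, map_smul_eq_mul, Circle.norm_coe, one_mul] at h5
    linarith

end Family

/-! ### From bounded representations to isometries and back. -/

section Bounded

variable {S X : Type*} [AddCommMonoid S] [NormedAddCommGroup X] [NormedSpace ℂ X]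

theorem map_comm (T : Representation S (X →L[ℂ] X)) (s t : S) (x : X) :
    T s (T t x) = T t (T s x) := by
  change (T s * T t) x = (T t * T s) x
  rw [← T.map_add_eq_mul, ← T.map_add_eq_mul, add_comm]

theorem map_add_apply (T : Representation S (X →L[ℂ] X)) (s t : S) (x : X) :
    T (s + t) x = T s (T t x) := by
  rw [T.map_add_eq_mul]; rfl

theorem bddAbove_orbit {T : Representation S (X →L[ℂ] X)} (hT : IsBounded T) (x : X) :
    BddAbove (Set.range fun s => ‖T s x‖) := by
  obtain ⟨M, hM⟩ := hT
  refine ⟨M * ‖x‖, ?_⟩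
  rintro _ ⟨s, rfl⟩
  exact (T s).le_of_opNorm_le (hM s) x

/-- The seminorm `sup_s ‖T s x‖`, for which a bounded representation is contractive. -/
noncomputable def orbitSeminorm {T : Representation S (X →L[ℂ] X)} (hT : IsBounded T) :
    Seminorm ℂ X :=
  Seminorm.of (fun x => ⨆ s, ‖T s x‖)
    (fun x y => ciSup_le fun s => by
      rw [map_add]
      exact (norm_add_le _ _).trans (add_le_add (le_ciSup (bddAbove_orbit hT x) s)
        (le_ciSup (bddAbove_orbit hT y) s)))
    (fun c x => by
      simp_rw [map_smul, norm_smul]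
      rw [Real.mul_iSup_of_nonneg (norm_nonneg c)])

theorem norm_apply_le_orbitSeminorm {T : Representation S (X →L[ℂ] X)} (hT : IsBounded T)
    (s : S) (x : X) : ‖T s x‖ ≤ orbitSeminorm hT x :=
  le_ciSup (bddAbove_orbit hT x) s

theorem norm_le_orbitSeminorm {T : Representation S (X →L[ℂ] X)} (hT : IsBounded T)
    (x : X) : ‖x‖ ≤ orbitSeminorm hT x := by
  simpa using norm_apply_le_orbitSeminorm hT 0 x

theorem orbitSeminorm_le {T : Representation S (X →L[ℂ] X)} (hT : IsBounded T) {M : ℝ}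
    (hM : ∀ s, ‖T s‖ ≤ M) (x : X) : orbitSeminorm hT x ≤ M * ‖x‖ :=
  ciSup_le fun s => (T s).le_of_opNorm_le (hM s) x

theorem orbitSeminorm_map_le {T : Representation S (X →L[ℂ] X)} (hT : IsBounded T)
    (t : S) (x : X) : orbitSeminorm hT (T t x) ≤ orbitSeminorm hT x :=
  ciSup_le fun s => by
    rw [← map_add_apply]; exact norm_apply_le_orbitSeminorm hT _ x

theorem bddBelow_orbitSeminorm {T : Representation S (X →L[ℂ] X)} (hT : IsBounded T) (x : X) :
    BddBelow (Set.range fun t => orbitSeminorm hT (T t x)) :=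
  ⟨0, by rintro _ ⟨t, rfl⟩; exact apply_nonneg _ _⟩

/-- The limit of the orbit seminorm along the semigroup, for which a bounded representation is
isometric. -/
noncomputable def asymptoticSeminorm {T : Representation S (X →L[ℂ] X)} (hT : IsBounded T) :
    Seminorm ℂ X :=
  Seminorm.of (fun x => ⨅ t, orbitSeminorm hT (T t x))
    (fun x y => le_ciInf_add_ciInf fun s t => by
      -- The orbit seminorm decreases along the semigroup, so the common later time `s + t` serves
      -- both summands.
      refine (ciInf_le (bddBelow_orbitSeminorm hT (x + y)) (s + t)).trans ?_
      rw [map_add]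
      refine (map_add_le_add _ _ _).trans (add_le_add ?_ ?_)
      · rw [add_comm, map_add_apply]; exact orbitSeminorm_map_le hT _ _
      · rw [map_add_apply]; exact orbitSeminorm_map_le hT _ _)
    (fun c x => by
      simp_rw [map_smul, map_smul_eq_mul]
      rw [Real.mul_iInf_of_nonneg (norm_nonneg c)])

theorem asymptoticSeminorm_le {T : Representation S (X →L[ℂ] X)} (hT : IsBounded T)
    (t : S) (x : X) : asymptoticSeminorm hT x ≤ orbitSeminorm hT (T t x) :=
  ciInf_le (bddBelow_orbitSeminorm hT x) t

theorem asymptoticSeminorm_map {T : Representation S (X →L[ℂ] X)} (hT : IsBounded T)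
    (s : S) (x : X) : asymptoticSeminorm hT (T s x) = asymptoticSeminorm hT x := by
  refine le_antisymm (le_ciInf fun t => ?_) (le_ciInf fun t => ?_)
  · refine (asymptoticSeminorm_le hT t _).trans ?_
    rw [map_comm]; exact orbitSeminorm_map_le hT _ _
  · rw [← map_add_apply]; exact asymptoticSeminorm_le hT _ x

/-- `χ` is an approximate joint eigenvalue of `T` with approximate eigenvectors in `W`. -/
def IsApproxEigenvalueOn (T : Representation S (X →L[ℂ] X)) (W : Submodule ℂ X)
    (χ : UnitaryDual S) : Prop :=
  ∀ (F : Finset S) (ε : ℝ), 0 < ε → ∃ x ∈ W, x ≠ 0 ∧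
    ∀ s ∈ F, ‖T s x - (χ s : ℂ) • x‖ ≤ ε * ‖x‖

/-- A bounded representation with an orbit that stays away from zero has a unitary approximate
eigenvalue. -/
theorem exists_isApproxEigenvalueOn {T : Representation S (X →L[ℂ] X)} (hT : IsBounded T)
    {W : Submodule ℂ X} (hW : ∀ s, ∀ x ∈ W, T s x ∈ W) {x : X} (hxW : x ∈ W) {δ : ℝ}
    (hδ : 0 < δ) (hx : ∀ s, δ ≤ ‖T s x‖) : ∃ χ : UnitaryDual S, IsApproxEigenvalueOn T W χ := by
  classical
  obtain ⟨M, hM⟩ := id hT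
  have hM' : ∀ s, ‖T s‖ ≤ max M 1 := fun s => (hM s).trans (le_max_left _ _)
  have hM0 : 0 < max M 1 := zero_lt_one.trans_le (le_max_right _ _)
  let U : AddChar S (Module.End ℂ X) :=
    { toFun := fun s => (T s).toLinearMap
      map_zero_eq_one' := by rw [T.map_zero_eq_one]; rfl
      map_add_eq_mul' := fun s t => by rw [T.map_add_eq_mul]; rfl }
  have hpx : 0 < asymptoticSeminorm hT x := hδ.trans_le <| le_ciInf fun t =>
    (hx t).trans (norm_le_orbitSeminorm hT _)
  obtain ⟨χ, hχ⟩ := exists_unitary_character_of_isometries (asymptoticSeminorm hT) U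
    (asymptoticSeminorm_map hT) W hW hxW hpx
  refine ⟨χ, fun F ε hε => ?_⟩
  -- The factor 2 gives the strict inequality needed to undercut the infimum at some actual time
  -- `t`.
  obtain ⟨y, hyW, hy, hyF⟩ := hχ F (ε / (2 * max M 1)) (by positivity)
  have h1 : ∀ s : S, ∃ t : S, s ∈ F → orbitSeminorm hT (T t (T s y - (χ s : ℂ) • y)) ≤
      ε / max M 1 * asymptoticSeminorm hT y := by
    intro s
    by_cases hs : s ∈ F
    · have h2 : asymptoticSeminorm hT (T s y - (χ s : ℂ) • y) <
          ε / max M 1 * asymptoticSeminorm hT y := by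
        refine (hyF s hs).trans_lt (mul_lt_mul_of_pos_right ?_ hy)
        exact div_lt_div_of_pos_left hε hM0 (by linarith)
      obtain ⟨t, ht⟩ := exists_lt_of_ciInf_lt h2
      exact ⟨t, fun _ => ht.le⟩
    · exact ⟨0, fun h => absurd h hs⟩
  choose t ht using h1
  -- Waiting for the sum of all the times makes every error small in norm, while `T r y` keeps at
  -- least the asymptotic size of `y` up to the bound of `T`.
  let r := ∑ s ∈ F, t s
  have hyr : asymptoticSeminorm hT y ≤ max M 1 * ‖T r y‖ :=
    (asymptoticSeminorm_le hT r y).trans (orbitSeminorm_le hT hM' _)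
  refine ⟨T r y, hW r y hyW, ?_, fun s hs => ?_⟩
  · intro h0
    rw [h0, norm_zero, mul_zero] at hyr
    exact absurd hyr (not_le.2 hy)
  · have h3 : T s (T r y) - (χ s : ℂ) • T r y =
        T (∑ a ∈ F.erase s, t a) (T (t s) (T s y - (χ s : ℂ) • y)) := by
      have h4 : ∀ w, T (∑ a ∈ F.erase s, t a) (T (t s) w) = T r w := fun w => by
        rw [← map_add_apply, Finset.sum_erase_add F t hs]
      rw [h4, map_sub, map_smul, map_comm]
    rw [h3]
    calc _ ≤ orbitSeminorm hT (T (t s) (T s y - (χ s : ℂ) • y)) :=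
          norm_apply_le_orbitSeminorm hT _ _
      _ ≤ ε / max M 1 * asymptoticSeminorm hT y := ht s hs
      _ ≤ ε / max M 1 * (max M 1 * ‖T r y‖) := by gcongr
      _ = ε * ‖T r y‖ := by field_simp

end Bounded

/-! ### The unitary spectrum, its poles, and quasi-compactness from Riesz points. -/

section Spectrum

variable {S E : Type*} [AddCommMonoid S] [NormedAddCommGroup E] [NormedSpace ℂ E]

theorem exists_opNorm_mul_lt_two_mul (c : E →L[ℂ] E) (hc : c ≠ 0) :
    ∃ x, ‖c‖ * ‖x‖ < 2 * ‖c x‖ := by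
  by_contra! h
  have h1 : ‖c‖ ≤ ‖c‖ / 2 := c.opNorm_le_bound (by positivity) fun x => by linarith [h x]
  have h2 : 0 < ‖c‖ := norm_pos_iff.2 hc
  linarith

theorem exists_approx_eigenvector_of_operator {T : Representation S (E →L[ℂ] E)}
    {χ : UnitaryDual S} {F : Finset S} {ε : ℝ} {c : E →L[ℂ] E} (hc : c ≠ 0)
    (h : ∀ s ∈ F, ‖T s * c - (χ s : ℂ) • c‖ ≤ ε / 2 * ‖c‖) :
    ∃ x, c x ≠ 0 ∧ ∀ s ∈ F, ‖T s (c x) - (χ s : ℂ) • c x‖ ≤ ε * ‖c x‖ := by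
  obtain ⟨x, hx⟩ := exists_opNorm_mul_lt_two_mul c hc
  refine ⟨x, fun h0 => ?_, fun s hs => ?_⟩
  · rw [h0, norm_zero, mul_zero] at hx
    exact absurd hx (not_lt.2 (by positivity))
  · have h1 : ‖T s (c x) - (χ s : ℂ) • c x‖ ≤ ε / 2 * ‖c‖ * ‖x‖ :=
      (T s * c - (χ s : ℂ) • c).le_of_opNorm_le (h s hs) x
    have hε : 0 ≤ ε / 2 := by
      by_contra hneg
      have := mul_neg_of_neg_of_pos (not_le.1 hneg) (norm_pos_iff.2 hc)
      linarith [(norm_nonneg _).trans (h s hs)]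
    calc _ ≤ ε / 2 * (‖c‖ * ‖x‖) := by rw [← mul_assoc]; exact h1
      _ ≤ ε / 2 * (2 * ‖c x‖) := by gcongr
      _ = _ := by ring

theorem IsApproxEigenvalueOn.exists_norm_eq_one {T : Representation S (E →L[ℂ] E)}
    {W : Submodule ℂ E} {χ : UnitaryDual S} (h : IsApproxEigenvalueOn T W χ) (F : Finset S)
    {ε : ℝ} (hε : 0 < ε) :
    ∃ x ∈ W, ‖x‖ = 1 ∧ ∀ s ∈ F, ‖T s x - (χ s : ℂ) • x‖ ≤ ε := by
  obtain ⟨x, hxW, hx0, hx⟩ := h F ε hε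
  have hn : 0 < ‖x‖ := norm_pos_iff.2 hx0
  have hnn : ‖((‖x‖⁻¹ : ℝ) : ℂ)‖ = ‖x‖⁻¹ := by
    rw [Complex.norm_real, norm_inv, norm_norm]
  refine ⟨((‖x‖⁻¹ : ℝ) : ℂ) • x, W.smul_mem _ hxW, ?_, fun s hs => ?_⟩
  · rw [norm_smul, hnn, inv_mul_cancel₀ hn.ne']
  · rw [map_smul, smul_comm, ← smul_sub, norm_smul, hnn, inv_mul_le_iff₀ hn, mul_comm]
    exact hx s hs

theorem tendsto_one_div_snd_add_one {α : Type*} [Preorder α] :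
    Tendsto (fun i : α × ℕ => 1 / ((i.2 : ℝ) + 1)) atTop (𝓝 0) := by
  rw [← prod_atTop_atTop_eq]
  exact tendsto_one_div_add_atTop_nhds_zero_nat.comp tendsto_snd

/-- An approximate eigenoperator `c` gives the vector `c x` for an `x` that norms `c` up to a factor
2; conversely a unit vector gives a rank-one operator of norm one. -/
theorem mem_unitarySpectrum_iff {T : Representation S (E →L[ℂ] E)} {χ : UnitaryDual S} :
    χ ∈ unitarySpectrum T ↔ IsApproxEigenvalueOn T ⊤ χ := by
  classical
  constructor
  · rintro ⟨l, hl, hl1, hlim⟩ F ε hε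
    have h1 : ∀ᶠ c in l, ∀ s ∈ F, ‖(algebraMap ℂ (E →L[ℂ] E) (χ s : ℂ) - T s) * c‖ < ε / 2 := by
      rw [Filter.eventually_all_finset]
      intro s _
      filter_upwards [Metric.tendsto_nhds.1 (hlim s) (ε / 2) (by positivity)] with c hc
      rwa [dist_zero_right] at hc
    obtain ⟨c, hc1, hc⟩ := (hl1.and h1).exists
    have hc0 : c ≠ 0 := fun h => by rw [h, norm_zero] at hc1; exact zero_ne_one hc1
    obtain ⟨x, hx0, hx⟩ := exists_approx_eigenvector_of_operator (T := T) (χ := χ) (F := F)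
      (ε := ε) hc0 fun s hs => by
        rw [hc1, mul_one, Algebra.smul_def, ← sub_mul, ← norm_neg, ← neg_mul, neg_sub]
        exact (hc s hs).le
    exact ⟨c x, Submodule.mem_top, hx0, hx⟩
  · intro h
    choose x _ hx1 hx using fun i : Finset S × ℕ =>
      h.exists_norm_eq_one i.1 (Nat.one_div_pos_of_nat (α := ℝ) (n := i.2))
    have : Nontrivial E := ⟨x (∅, 0), 0, fun h0 => by
      have := hx1 (∅, 0); rw [h0, norm_zero] at this; exact zero_ne_one this⟩
    obtain ⟨f, hf, -⟩ := exists_dual_vector' ℂ (0 : E)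
    have hnorm : ∀ y : E, ‖f.smulRight y‖ = ‖y‖ := fun y => by
      rw [ContinuousLinearMap.norm_smulRight_apply, hf, one_mul]
    refine ⟨map (fun i => f.smulRight (x i)) atTop, inferInstance, ?_, fun s => ?_⟩
    · exact Filter.eventually_map.2 (Eventually.of_forall fun i => by rw [hnorm, hx1])
    · rw [tendsto_map'_iff, tendsto_zero_iff_norm_tendsto_zero]
      refine squeeze_zero' (Eventually.of_forall fun i => norm_nonneg _) ?_
        tendsto_one_div_snd_add_one
      filter_upwards [eventually_ge_atTop (({s} : Finset S), 0)] with i hi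
      have h3 : (algebraMap ℂ (E →L[ℂ] E) (χ s : ℂ) - T s) * f.smulRight (x i) =
          f.smulRight (-(T s (x i) - (χ s : ℂ) • x i)) := by
        ext y
        rw [Algebra.algebraMap_eq_smul_one, neg_sub]
        change (χ s : ℂ) • (f y • x i) - T s (f y • x i) = f y • ((χ s : ℂ) • x i - T s (x i))
        rw [map_smul, smul_sub, smul_comm]
      change ‖(algebraMap ℂ (E →L[ℂ] E) (χ s : ℂ) - T s) * f.smulRight (x i)‖ ≤ _
      rw [h3, hnorm, norm_neg]
      exact hx i s (hi.1 (Finset.mem_singleton_self s))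

theorem mem_unitarySpectrum_restrict_iff {T : Representation S (E →L[ℂ] E)} {W : Submodule ℂ E}
    (hW : ∀ s : S, ∀ x ∈ W, T s x ∈ W) {χ : UnitaryDual S} :
    χ ∈ unitarySpectrum (A := W →L[ℂ] W) (restrict T W hW) ↔ IsApproxEigenvalueOn T W χ := by
  rw [mem_unitarySpectrum_iff]
  refine forall₃_congr fun F ε hε => ⟨?_, ?_⟩
  · rintro ⟨x, -, hx0, hx⟩
    exact ⟨x, x.2, fun h => hx0 (Subtype.ext h), hx⟩
  · rintro ⟨x, hxW, hx0, hx⟩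
    exact ⟨⟨x, hxW⟩, Submodule.mem_top, fun h => hx0 (congrArg Subtype.val h), hx⟩

theorem IsApproxEigenvalueOn.mono {T : Representation S (E →L[ℂ] E)} {V W : Submodule ℂ E}
    {χ : UnitaryDual S} (h : IsApproxEigenvalueOn T V χ) (hVW : V ≤ W) :
    IsApproxEigenvalueOn T W χ := fun F ε hε => by
  obtain ⟨x, hx, h⟩ := h F ε hε
  exact ⟨x, hVW hx, h⟩

theorem IsApproxEigenvalueOn.of_tendsto {T : Representation S (E →L[ℂ] E)} {W : Submodule ℂ E}
    {χ : UnitaryDual S} {ι : Type*} {l : Filter ι} [l.NeBot] {ψ : ι → UnitaryDual S}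
    (hψ : ∀ s, Tendsto (fun i => ψ i s) l (𝓝 (χ s)))
    (h : ∀ᶠ i in l, IsApproxEigenvalueOn T W (ψ i)) : IsApproxEigenvalueOn T W χ := by
  intro F ε hε
  have h1 : ∀ᶠ i in l, ∀ s ∈ F, ‖(ψ i s : ℂ) - χ s‖ < ε / 2 := by
    rw [Filter.eventually_all_finset]
    intro s _
    have : Tendsto (fun i => (ψ i s : ℂ)) l (𝓝 (χ s : ℂ)) :=
      (continuous_induced_dom.tendsto _).comp (hψ s)
    filter_upwards [Metric.tendsto_nhds.1 this (ε / 2) (by positivity)] with i hi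
    rwa [dist_eq_norm] at hi
  obtain ⟨i, hi1, hi⟩ := (h1.and h).exists
  obtain ⟨x, hxW, hx0, hx⟩ := hi F (ε / 2) (by positivity)
  refine ⟨x, hxW, hx0, fun s hs => ?_⟩
  have h2 : T s x - (χ s : ℂ) • x = (T s x - (ψ i s : ℂ) • x) + ((ψ i s : ℂ) - χ s) • x := by
    rw [sub_smul]; abel
  rw [h2]
  refine (norm_add_le _ _).trans ?_
  rw [norm_smul]
  have h3 := mul_le_mul_of_nonneg_right (hi1 s hs).le (norm_nonneg x)
  linarith [hx s hs]

/-- Compactness of the unitary dual for pointwise convergence: the character equations are closed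
conditions on a product of circles. -/
theorem exists_tendsto_unitaryDual {ι : Type*} (𝒰 : Ultrafilter ι) (ψ : ι → UnitaryDual S) :
    ∃ χ : UnitaryDual S, ∀ s, Tendsto (fun i => ψ i s) 𝒰 (𝓝 (χ s)) := by
  have hlim : ∀ s, ∃ w : Circle, Tendsto (fun i => ψ i s) 𝒰 (𝓝 w) := fun s => by
    obtain ⟨w, -, hw⟩ := isCompact_univ.ultrafilter_le_nhds (𝒰.map fun i => ψ i s) (by simp)
    exact ⟨w, hw⟩
  choose w hw using hlim
  refine ⟨{ toFun := w, map_zero_eq_one' := ?_, map_add_eq_mul' := fun s t => ?_ }, hw⟩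
  · have := hw 0
    simp only [AddChar.map_zero_eq_one] at this
    exact (tendsto_nhds_unique this tendsto_const_nhds)
  · have := hw (s + t)
    simp only [AddChar.map_add_eq_mul] at this
    exact tendsto_nhds_unique this ((hw s).mul (hw t))

theorem isPole_iff {T : Representation S (E →L[ℂ] E)} {χ : UnitaryDual S} :
    IsPole T χ ↔ ∃ P : E →L[ℂ] E, (∀ s, P * T s = T s * P) ∧ P * P = P ∧
      LinearMap.range P.toLinearMap = eigenspace T χ ∧
      ¬ IsApproxEigenvalueOn T (LinearMap.ker P.toLinearMap) χ := by
  constructor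
  · rintro ⟨P, hP, h1, h2, h3⟩
    exact ⟨P, hP, h1, h2, fun h => h3 ((mem_unitarySpectrum_restrict_iff _).2 h)⟩
  · rintro ⟨P, hP, h1, h2, h3⟩
    exact ⟨P, hP, h1, h2, fun h => h3 ((mem_unitarySpectrum_restrict_iff _).1 h)⟩

/-- For an approximate `ψ`-eigenvector `x`, the vector `P x` is a `χ`-eigenvector and nearly a
`ψ`-eigenvector, so it is small where `ψ` and `χ` differ. Hence `x - P x` keeps at least half the
norm of `x` and can replace it. -/
theorem IsApproxEigenvalueOn.ker_of_ne {T : Representation S (E →L[ℂ] E)} {χ ψ : UnitaryDual S}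
    {P : E →L[ℂ] E} (hP : ∀ s, P * T s = T s * P) (hPP : P * P = P)
    (hr : LinearMap.range P.toLinearMap ≤ eigenspace T χ) (hne : ψ ≠ χ)
    (h : IsApproxEigenvalueOn T ⊤ ψ) :
    IsApproxEigenvalueOn T (LinearMap.ker P.toLinearMap) ψ := by
  classical
  obtain ⟨a, ha⟩ := DFunLike.ne_iff.1 hne
  have hη : 0 < ‖(χ a : ℂ) - ψ a‖ :=
    norm_pos_iff.2 (sub_ne_zero.2 fun h => ha (Circle.ext h.symm))
  set η := ‖(χ a : ℂ) - ψ a‖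
  intro F ε hε
  have hP0 : 0 ≤ ‖P‖ := norm_nonneg P
  obtain ⟨x, -, hx0, hx⟩ := h (insert a F) (min (η / (2 * (‖P‖ + 1))) (ε / (2 * (1 + ‖P‖))))
    (by positivity)
  have hPT : ∀ s y, P (T s y) = T s (P y) := fun s y =>
    congrArg (fun R : E →L[ℂ] E => R y) (hP s)
  have hTP : ∀ s y, T s (P y) = (χ s : ℂ) • P y := fun s y => hr ⟨y, rfl⟩ s
  have hxn : 0 < ‖x‖ := norm_pos_iff.2 hx0
  have h1 : ‖P x‖ ≤ ‖x‖ / 2 := by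
    have h2 : ((χ a : ℂ) - ψ a) • P x = P (T a x - (ψ a : ℂ) • x) := by
      rw [map_sub, map_smul, hPT, hTP, sub_smul]
    have h3 : η * ‖P x‖ ≤ ‖P‖ * (η / (2 * (‖P‖ + 1)) * ‖x‖) := by
      rw [← norm_smul, h2]
      refine (P.le_opNorm _).trans (mul_le_mul_of_nonneg_left ?_ hP0)
      exact (hx a (Finset.mem_insert_self a F)).trans
        (mul_le_mul_of_nonneg_right (min_le_left _ _) hxn.le)
    have h4 : ‖P‖ * (η / (2 * (‖P‖ + 1)) * ‖x‖) ≤ η * (‖x‖ / 2) := by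
      have : ‖P‖ * (η / (2 * (‖P‖ + 1)) * ‖x‖) = ‖P‖ / (‖P‖ + 1) * (η * (‖x‖ / 2)) := by
        field_simp
      rw [this]
      exact mul_le_of_le_one_left (by positivity) ((div_le_one (by positivity)).2 (by linarith))
    exact le_of_mul_le_mul_left (h3.trans h4) hη
  have h5 : ‖x‖ / 2 ≤ ‖x - P x‖ := by linarith [norm_sub_norm_le x (P x)]
  refine ⟨x - P x, ?_, ?_, fun s hs => ?_⟩
  · change P (x - P x) = 0
    rw [map_sub, sub_eq_zero]
    exact (congrArg (fun R : E →L[ℂ] E => R x) hPP).symm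
  · exact norm_pos_iff.1 (lt_of_lt_of_le (by positivity) h5)
  · have h6 : T s (x - P x) - (ψ s : ℂ) • (x - P x) =
        (T s x - (ψ s : ℂ) • x) - P (T s x - (ψ s : ℂ) • x) := by
      rw [map_sub, map_sub, map_smul, hPT, smul_sub]; abel
    have h7 : ‖T s x - (ψ s : ℂ) • x‖ ≤ ε / (2 * (1 + ‖P‖)) * ‖x‖ :=
      (hx s (Finset.mem_insert_of_mem hs)).trans
        (mul_le_mul_of_nonneg_right (min_le_right _ _) hxn.le)
    rw [h6]
    calc _ ≤ ‖T s x - (ψ s : ℂ) • x‖ + ‖P (T s x - (ψ s : ℂ) • x)‖ := norm_sub_le _ _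
      _ ≤ ‖T s x - (ψ s : ℂ) • x‖ + ‖P‖ * ‖T s x - (ψ s : ℂ) • x‖ := by
          gcongr; exact P.le_opNorm _
      _ = (1 + ‖P‖) * ‖T s x - (ψ s : ℂ) • x‖ := by ring
      _ ≤ (1 + ‖P‖) * (ε / (2 * (1 + ‖P‖)) * ‖x‖) := by gcongr
      _ = ε * (‖x‖ / 2) := by field_simp
      _ ≤ _ := by gcongr

/-- If the unitary spectrum consists of poles then it is finite. -/
theorem finite_of_forall_isPole {T : Representation S (E →L[ℂ] E)}
    (h : ∀ χ ∈ unitarySpectrum T, IsPole T χ) : (unitarySpectrum T).Finite := by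
  by_contra hinf
  have : Infinite (unitarySpectrum T) := Set.infinite_coe_iff.2 hinf
  -- The hyperfilter avoids every single point, so `χ` is an accumulation point of the spectrum and
  -- the characters tending to it may be taken different from it.
  obtain ⟨χ, hχ⟩ := exists_tendsto_unitaryDual (hyperfilter (unitarySpectrum T))
    (fun i => (i : UnitaryDual S))
  have hmem : IsApproxEigenvalueOn T ⊤ χ := .of_tendsto hχ
    (Eventually.of_forall fun i => mem_unitarySpectrum_iff.1 i.2)
  have hχσ := mem_unitarySpectrum_iff.2 hmem
  obtain ⟨P, hP, hPP, hr, hn⟩ := isPole_iff.1 (h χ hχσ)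
  refine hn (.of_tendsto hχ ?_)
  have hne : ∀ᶠ i in (hyperfilter (unitarySpectrum T) : Filter (unitarySpectrum T)),
      i ≠ ⟨χ, hχσ⟩ :=
    (Set.finite_singleton (⟨χ, hχσ⟩ : unitarySpectrum T)).compl_mem_hyperfilter
  filter_upwards [hne] with i hi
  exact (mem_unitarySpectrum_iff.1 i.2).ker_of_ne hP hPP hr.le fun h => hi (Subtype.ext h)

theorem isCompactOperator_of_finiteDimensional_range (P : E →L[ℂ] E)
    (h : FiniteDimensional ℂ (LinearMap.range P.toLinearMap)) : IsCompactOperator P := by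
  have h1 : IsCompactOperator (id : LinearMap.range P.toLinearMap → _) :=
    (isCompactOperator_id_iff_finiteDimensional (𝕜 := ℂ)).2 h
  have h2 := (h1.comp_clm (P.codRestrict (LinearMap.range P.toLinearMap) fun x => ⟨x, rfl⟩)).clm_comp
    (LinearMap.range P.toLinearMap).subtypeL
  exact h2

theorem isQuasiCompact_of_forall_isRieszPoint {T : Representation S (E →L[ℂ] E)}
    (hT : IsBounded T) (h : ∀ χ ∈ unitarySpectrum T, IsRieszPoint T χ) : IsQuasiCompact T := by
  classical
  have hfin := finite_of_forall_isPole fun χ hχ => (h χ hχ).1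
  have hex : ∀ χ ∈ unitarySpectrum T, ∃ P : E →L[ℂ] E, (∀ s, P * T s = T s * P) ∧ P * P = P ∧
      LinearMap.range P.toLinearMap = eigenspace T χ ∧
      ¬ IsApproxEigenvalueOn T (LinearMap.ker P.toLinearMap) χ := fun χ hχ =>
    isPole_iff.1 (h χ hχ).1
  choose! P hPT hPP hr hn using hex
  have hTP : ∀ χ ∈ unitarySpectrum T, ∀ s, T s * P χ = (χ s : ℂ) • P χ := fun χ hχ s => by
    ext y
    exact (hr χ hχ).le ⟨y, rfl⟩ s
  have horth : ∀ χ ∈ unitarySpectrum T, ∀ ψ ∈ unitarySpectrum T, ψ ≠ χ → P χ * P ψ = 0 := by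
    intro χ hχ ψ hψ hne
    obtain ⟨a, ha⟩ := DFunLike.ne_iff.1 hne
    have h1 : (χ a : ℂ) • (P χ * P ψ) = (ψ a : ℂ) • (P χ * P ψ) := by
      rw [← smul_mul_assoc, ← hTP χ hχ, ← hPT χ hχ, mul_assoc, hTP ψ hψ, mul_smul_comm]
    rw [← sub_eq_zero, ← sub_smul, smul_eq_zero, sub_eq_zero] at h1
    exact h1.resolve_left fun h => ha (Circle.ext h.symm)
  set P₀ : E →L[ℂ] E := ∑ χ ∈ hfin.toFinset, P χ with hP₀
  have hPP₀ : ∀ χ ∈ unitarySpectrum T, P χ * P₀ = P χ := by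
    intro χ hχ
    rw [hP₀, Finset.mul_sum, Finset.sum_eq_single χ, hPP χ hχ]
    · exact fun ψ hψ hne => horth χ hχ ψ (hfin.mem_toFinset.1 hψ) hne
    · exact fun h => absurd (hfin.mem_toFinset.2 hχ) h
  have hP₀P₀ : P₀ * P₀ = P₀ := by
    conv_lhs => rw [hP₀, Finset.sum_mul]
    rw [← hP₀]
    exact Finset.sum_congr rfl fun χ hχ => hPP₀ χ (hfin.mem_toFinset.1 hχ)
  have hcomm : ∀ s, P₀ * T s = T s * P₀ := fun s => by
    rw [hP₀, Finset.sum_mul, Finset.mul_sum]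
    exact Finset.sum_congr rfl fun χ hχ => hPT χ (hfin.mem_toFinset.1 hχ) s
  have hcompact : ∀ s, IsCompactOperator (T s * P₀ : E →L[ℂ] E) := by
    intro s
    have h1 : P₀ ∈ compactOperator (RingHom.id ℂ) E E :=
      Submodule.sum_mem _ fun χ hχ => by
        have hχ' := hfin.mem_toFinset.1 hχ
        refine isCompactOperator_of_finiteDimensional_range (P χ) ?_
        rw [hr χ hχ']
        exact (h χ hχ').2
    exact IsCompactOperator.clm_comp h1 (T s)
  by_contra hq
  have hq' : ∀ s, 1 ≤ ‖T s * (1 - P₀)‖ := fun s => by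
    by_contra hlt
    refine hq ⟨s, T s * P₀, hcompact s, ?_⟩
    rw [mul_sub, mul_one] at hlt
    exact not_le.1 hlt
  -- The lower bound concerns operator norms, and no single vector need witness it for all `s`; so
  -- the existence theorem is applied on the operator space, with `1 - P₀` as the starting vector.
  let L : Representation S ((E →L[ℂ] E) →L[ℂ] (E →L[ℂ] E)) :=
    { toFun := fun s => ContinuousLinearMap.mul ℂ (E →L[ℂ] E) (T s)
      map_zero_eq_one' := by
        ext c x
        simp
      map_add_eq_mul' := fun s t => by
        ext c x
        simp [AddChar.map_add_eq_mul] }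
  have hL : IsBounded (A := (E →L[ℂ] E) →L[ℂ] (E →L[ℂ] E)) L := by
    obtain ⟨M, hM⟩ := hT
    exact ⟨M, fun s => (ContinuousLinearMap.opNorm_mul_apply_le ℂ _ (T s)).trans (hM s)⟩
  let W : Submodule ℂ (E →L[ℂ] E) :=
    LinearMap.ker (ContinuousLinearMap.mul ℂ (E →L[ℂ] E) P₀).toLinearMap
  have hW : ∀ c, c ∈ W ↔ P₀ * c = 0 := fun c => Iff.rfl
  obtain ⟨χ, hχ⟩ := exists_isApproxEigenvalueOn hL (W := W) (x := 1 - P₀)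
    (fun s c hc => by
      rw [hW] at hc ⊢
      change P₀ * (T s * c) = 0
      rw [← mul_assoc, hcomm, mul_assoc, hc, mul_zero])
    (by rw [hW, mul_sub, mul_one, hP₀P₀, sub_self]) one_pos hq'
  have hχ₀ : IsApproxEigenvalueOn T (LinearMap.ker P₀.toLinearMap) χ := by
    intro F ε hε
    obtain ⟨c, hcW, hc0, hc⟩ := hχ F (ε / 2) (by positivity)
    obtain ⟨x, hx0, hx⟩ := exists_approx_eigenvector_of_operator (T := T) hc0 hc
    exact ⟨c x, congrArg (fun R : E →L[ℂ] E => R x) ((hW c).1 hcW), hx0, hx⟩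
  have hχσ : χ ∈ unitarySpectrum T := mem_unitarySpectrum_iff.2 (hχ₀.mono le_top)
  refine hn χ hχσ (hχ₀.mono fun x hx => ?_)
  change P χ x = 0
  have hx' : P₀ x = 0 := hx
  rw [← hPP₀ χ hχσ]
  change P χ (P₀ x) = 0
  rw [hx', map_zero]

end Spectrum

/-! ### Eigenspaces and ergodic projections of quasi-compact representations. -/

section QuasiCompact

variable {S E : Type*} [AddCommMonoid S] [NormedAddCommGroup E] [NormedSpace ℂ E]

/-- Bounded approximate eigenvectors of a quasi-compact operator for a unimodular eigenvalue
converge along ultrafilters. -/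
theorem exists_tendsto_of_approx_eigenvectors [CompleteSpace E] {U K : E →L[ℂ] E}
    (hK : IsCompactOperator K) (hUK : ‖U - K‖ < 1) (z : Circle) {ι : Type*} (𝒰 : Ultrafilter ι)
    {f : ι → E} {B : ℝ} (hB : ∀ᶠ i in (𝒰 : Filter ι), ‖f i‖ ≤ B)
    (hf : Tendsto (fun i => U (f i) - (z : ℂ) • f i) 𝒰 (𝓝 0)) :
    ∃ x, Tendsto f 𝒰 (𝓝 x) := by
  obtain ⟨C, hC, hKC⟩ := hK.image_closedBall_subset_compact (f := K.toLinearMap) B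
  obtain ⟨y, -, hy⟩ := hC.ultrafilter_le_nhds (𝒰.map fun i => K (f i)) (by
    rw [le_principal_iff]
    change ∀ᶠ i in (𝒰 : Filter ι), K (f i) ∈ C
    filter_upwards [hB] with i hi
    exact hKC ⟨f i, mem_closedBall_zero_iff.2 hi, rfl⟩)
  have hy' : Tendsto (fun i => K (f i)) 𝒰 (𝓝 y) := hy
  have hz : (z : ℂ) ≠ 0 := Circle.coe_ne_zero z
  -- This Neumann series inverse recovers `f i` continuously from `K (f i)` and the vanishing error.
  obtain ⟨u, hu⟩ : IsUnit (1 - (z : ℂ)⁻¹ • (U - K)) := by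
    refine isUnit_one_sub_of_norm_lt_one ?_
    rw [norm_smul, norm_inv, Circle.norm_coe, inv_one, one_mul]
    exact hUK
  have h1 : ∀ i, f i = (↑u⁻¹ : E →L[ℂ] E)
      ((z : ℂ)⁻¹ • (K (f i) - (U (f i) - (z : ℂ) • f i))) := by
    intro i
    have h2 : (z : ℂ)⁻¹ • (K (f i) - (U (f i) - (z : ℂ) • f i)) = (u : E →L[ℂ] E) (f i) := by
      rw [hu]
      change _ = f i - (z : ℂ)⁻¹ • (U (f i) - K (f i))
      rw [smul_sub, smul_sub, smul_sub, smul_smul, inv_mul_cancel₀ hz, one_smul]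
      abel
    rw [h2]
    change f i = ((↑u⁻¹ : E →L[ℂ] E) * (u : E →L[ℂ] E)) (f i)
    rw [Units.inv_mul]; rfl
  refine ⟨(↑u⁻¹ : E →L[ℂ] E) ((z : ℂ)⁻¹ • (y - 0)), ?_⟩
  refine (((↑u⁻¹ : E →L[ℂ] E).continuous.tendsto _).comp
    ((hy'.sub hf).const_smul ((z : ℂ)⁻¹))).congr fun i => (h1 i).symm

/-- The operator is a product of Cesàro means of `(χ a)⁻¹ • T a` over `a ∈ F`. Each mean contracts
the orbit seminorm, so the product is bounded independently of `F` and `ε`. -/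
theorem exists_approx_mean {T : Representation S (E →L[ℂ] E)} (hT : IsBounded T)
    (χ : UnitaryDual S) (F : Finset S) : ∀ ε : ℝ, 0 < ε → ∃ A : E →L[ℂ] E,
      (∀ x, orbitSeminorm hT (A x) ≤ orbitSeminorm hT x) ∧ (∀ s, Commute A (T s)) ∧
      (∀ x ∈ eigenspace T χ, A x = x) ∧
      ∀ s ∈ F, ∀ x, ‖T s (A x) - (χ s : ℂ) • A x‖ ≤ ε * ‖x‖ := by
  classical
  obtain ⟨M, hM⟩ := id hT
  have hM' : ∀ s, ‖T s‖ ≤ max M 1 := fun s => (hM s).trans (le_max_left _ _)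
  have hM0 : 0 < max M 1 := zero_lt_one.trans_le (le_max_right _ _)
  have hle := orbitSeminorm_le hT hM'
  set p := orbitSeminorm hT with hp
  induction F using Finset.induction_on with
  | empty => exact fun ε _ => ⟨1, fun x => le_rfl, fun s => Commute.one_left _, fun x _ => rfl,
      fun s hs => absurd hs (Finset.notMem_empty s)⟩
  | insert a F ha ih =>
    intro ε hε
    obtain ⟨A, hAp, hAT, hAe, hA⟩ := ih (ε / max M 1) (by positivity)
    obtain ⟨n, hn⟩ := exists_nat_gt (max 1 (2 * max M 1 / ε))
    have hn1 : (1 : ℝ) < n := (le_max_left _ _).trans_lt hn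
    have hn0 : (0 : ℝ) < n := zero_lt_one.trans hn1
    have hnε : 2 * max M 1 ≤ n * ε := by
      have := (le_max_right _ _).trans_lt hn
      rw [div_lt_iff₀ hε] at this
      exact this.le
    have hz : (χ a : ℂ) ≠ 0 := Circle.coe_ne_zero _
    have hzn : ‖((n : ℂ)⁻¹)‖ = (n : ℝ)⁻¹ := by rw [norm_inv, Complex.norm_natCast]
    set V : E →L[ℂ] E := (χ a : ℂ)⁻¹ • T a with hV
    have hVp : ∀ x, p (V x) ≤ p x := fun x => by
      change p ((χ a : ℂ)⁻¹ • T a x) ≤ _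
      rw [map_smul_eq_mul, norm_inv, Circle.norm_coe, inv_one, one_mul]
      exact orbitSeminorm_map_le hT a x
    have hVkp : ∀ k x, p ((V ^ k) x) ≤ p x := by
      intro k
      induction k with
      | zero => exact fun x => le_rfl
      | succ k ihk =>
        intro x
        rw [pow_succ']
        exact (hVp _).trans (ihk x)
    have hVT : ∀ s, Commute V (T s) := fun s => by
      have h1 : Commute (T a) (T s) := by
        rw [Commute, SemiconjBy, ← T.map_add_eq_mul, ← T.map_add_eq_mul, add_comm]
      exact h1.smul_left _
    set D : E →L[ℂ] E := (n : ℂ)⁻¹ • ∑ k ∈ Finset.range n, V ^ k with hD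
    have hDp : ∀ x, p (D x) ≤ p x := fun x => by
      rw [hD, _root_.smul_apply, map_smul_eq_mul, hzn, _root_.sum_apply,
        inv_mul_le_iff₀ hn0]
      refine (seminorm_sum_le p _ _).trans ((Finset.sum_le_sum fun k _ => hVkp k x).trans ?_)
      simp
    have hDT : ∀ s, Commute D (T s) := fun s =>
      (Commute.sum_left _ _ _ fun k _ => (hVT s).pow_left k).smul_left _
    refine ⟨A * D, fun x => (hAp _).trans (hDp x), fun s => (hAT s).mul_left (hDT s), ?_, ?_⟩
    · intro x hx
      have hVx : ∀ k, (V ^ k) x = x := by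
        intro k
        induction k with
        | zero => rfl
        | succ k ihk =>
          rw [pow_succ']
          change V ((V ^ k) x) = x
          rw [ihk]
          change (χ a : ℂ)⁻¹ • T a x = x
          rw [hx a, smul_smul, inv_mul_cancel₀ hz, one_smul]
      have hDx : D x = x := by
        rw [hD, _root_.smul_apply, _root_.sum_apply]
        simp_rw [hVx]
        rw [Finset.sum_const, Finset.card_range, ← Nat.cast_smul_eq_nsmul ℂ, smul_smul,
          inv_mul_cancel₀ (by exact_mod_cast hn0.ne'), one_smul]
      change A (D x) = x
      rw [hDx, hAe x hx]
    · intro s hs x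
      rcases Finset.mem_insert.1 hs with rfl | hsF
      -- For the new element the mean telescopes to `(V ^ n - 1) / n`, which the choice of `n` makes
      -- small.
      · have h1 : T s ((A * D) x) - (χ s : ℂ) • (A * D) x =
            A (((χ s : ℂ) * (n : ℂ)⁻¹) • ((V ^ n) x - x)) := by
          have h2 : T s = (χ s : ℂ) • V := by
            rw [hV, smul_smul, mul_inv_cancel₀ hz, one_smul]
          have h3 : T s * (A * D) - (χ s : ℂ) • (A * D) =
              A * (((χ s : ℂ) * (n : ℂ)⁻¹) • (V ^ n - 1)) := by
            rw [← mul_assoc, ← (hAT s).eq, mul_assoc, h2, ← mul_smul_comm, ← mul_sub,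
              smul_mul_assoc, ← smul_sub, hD, mul_smul_comm (n : ℂ)⁻¹ V, ← smul_sub,
              smul_smul, ← mul_geom_sum V n, sub_mul, one_mul]
          exact congrArg (fun R : E →L[ℂ] E => R x) h3
        rw [h1]
        calc _ ≤ p (A (((χ s : ℂ) * (n : ℂ)⁻¹) • ((V ^ n) x - x))) := norm_le_orbitSeminorm hT _
          _ ≤ p (((χ s : ℂ) * (n : ℂ)⁻¹) • ((V ^ n) x - x)) := hAp _
          _ = (n : ℝ)⁻¹ * p ((V ^ n) x - x) := by
              rw [map_smul_eq_mul, norm_mul, hzn, Circle.norm_coe, one_mul]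
          _ ≤ (n : ℝ)⁻¹ * (max M 1 * ‖x‖ + max M 1 * ‖x‖) := by
              gcongr
              exact (map_sub_le_add p _ _).trans
                (add_le_add ((hVkp n x).trans (hle x)) (hle x))
          _ ≤ ε * ‖x‖ := by
              rw [inv_mul_le_iff₀ hn0, ← mul_assoc, ← two_mul, ← mul_assoc]
              gcongr
      · have h1 : T s ((A * D) x) = T s (A (D x)) := rfl
        calc _ ≤ ε / max M 1 * ‖D x‖ := hA s hsF (D x)
          _ ≤ ε / max M 1 * (max M 1 * ‖x‖) := by
              gcongr
              exact (norm_le_orbitSeminorm hT _).trans ((hDp x).trans (hle x))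
          _ = _ := by field_simp

theorem mem_eigenspace_of_tendsto {T : Representation S (E →L[ℂ] E)} {χ : UnitaryDual S}
    {ι : Type*} {l : Filter ι} [l.NeBot] {f : ι → E} {x : E} (hf : Tendsto f l (𝓝 x))
    (h : ∀ s, Tendsto (fun i => T s (f i) - (χ s : ℂ) • f i) l (𝓝 0)) : x ∈ eigenspace T χ :=
  fun s => sub_eq_zero.1 (tendsto_nhds_unique
    ((((T s).continuous.tendsto x).comp hf).sub (hf.const_smul (χ s : ℂ))) (h s))

variable [CompleteSpace E]

theorem finiteDimensional_eigenspace {T : Representation S (E →L[ℂ] E)}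
    (hq : IsQuasiCompact T) (χ : UnitaryDual S) : FiniteDimensional ℂ (eigenspace T χ) := by
  obtain ⟨a, K, hK, hTK⟩ := hq
  refine FiniteDimensional.of_isCompact_closedBall₀ ℂ one_pos
    (isCompact_iff_ultrafilter_le_nhds.2 fun 𝒰 h𝒰 => ?_)
  have hball : ∀ᶠ v : eigenspace T χ in (𝒰 : Filter (eigenspace T χ)), ‖(v : E)‖ ≤ 1 := by
    filter_upwards [le_principal_iff.1 h𝒰] with v hv
    exact mem_closedBall_zero_iff.1 hv
  have hzero : ∀ s, Tendsto (fun v : eigenspace T χ => T s (v : E) - (χ s : ℂ) • (v : E)) 𝒰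
      (𝓝 0) := fun s => by
    refine tendsto_const_nhds.congr fun v => ?_
    rw [v.2 s, sub_self]
  obtain ⟨x, hx⟩ := exists_tendsto_of_approx_eigenvectors hK hTK (χ a) 𝒰
    (f := fun v : eigenspace T χ => (v : E)) hball (hzero a)
  exact ⟨⟨x, mem_eigenspace_of_tendsto hx hzero⟩,
    mem_closedBall_zero_iff.2 (le_of_tendsto hx.norm hball),
    (tendsto_subtype_rng (f := fun v : eigenspace T χ => v)).2 hx⟩

/-- The approximate means converge strongly along an ultrafilter, and the limit inherits commutation
with `T` and the identity on the eigenspace. -/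
theorem isPole_of_isQuasiCompact {T : Representation S (E →L[ℂ] E)} (hT : IsBounded T)
    (hq : IsQuasiCompact T) (χ : UnitaryDual S) : IsPole T χ := by
  classical
  obtain ⟨a, K, hK, hTK⟩ := hq
  obtain ⟨M, hM⟩ := id hT
  let 𝒰 : Ultrafilter (Finset S × ℕ) := Ultrafilter.of atTop
  have h𝒰 : (𝒰 : Filter (Finset S × ℕ)) ≤ atTop := Ultrafilter.of_le atTop
  have hsmall : Tendsto (fun i : Finset S × ℕ => 1 / ((i.2 : ℝ) + 1)) 𝒰 (𝓝 0) :=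
    tendsto_one_div_snd_add_one.mono_left h𝒰
  have hmem : ∀ s, ∀ᶠ i in (𝒰 : Filter (Finset S × ℕ)), s ∈ i.1 := fun s => by
    filter_upwards [h𝒰 (eventually_ge_atTop (({s} : Finset S), 0))] with i hi
    exact hi.1 (Finset.mem_singleton_self s)
  choose A hAp hAT hAe hA using fun i : Finset S × ℕ =>
    exists_approx_mean hT χ i.1 _ (Nat.one_div_pos_of_nat (α := ℝ) (n := i.2))
  have hAM : ∀ i x, ‖A i x‖ ≤ M * ‖x‖ := fun i x =>
    (norm_le_orbitSeminorm hT _).trans ((hAp i x).trans (orbitSeminorm_le hT hM x))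
  have hA0 : ∀ x s, Tendsto (fun i => T s (A i x) - (χ s : ℂ) • A i x) 𝒰 (𝓝 0) := by
    intro x s
    rw [tendsto_zero_iff_norm_tendsto_zero]
    refine squeeze_zero' (Eventually.of_forall fun i => norm_nonneg _) ?_
      (by simpa using hsmall.mul_const ‖x‖)
    filter_upwards [hmem s] with i hi
    simpa using hA i s hi x
  have hlim : ∀ x, ∃ y, Tendsto (fun i => A i x) 𝒰 (𝓝 y) := fun x =>
    exists_tendsto_of_approx_eigenvectors hK hTK (χ a) 𝒰
      (Eventually.of_forall fun i => hAM i x) (hA0 x a)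
  choose Q hQ using hlim
  let P : E →L[ℂ] E := LinearMap.mkContinuous
    { toFun := Q
      map_add' := fun x y => tendsto_nhds_unique (hQ (x + y)) <|
        ((hQ x).add (hQ y)).congr fun i => (map_add (A i) x y).symm
      map_smul' := fun c x => tendsto_nhds_unique (hQ (c • x)) <|
        ((hQ x).const_smul c).congr fun i => (map_smul (A i) c x).symm } M
    fun x => le_of_tendsto (hQ x).norm (Eventually.of_forall fun i => hAM i x)
  have hP : ∀ x, Tendsto (fun i => A i x) 𝒰 (𝓝 (P x)) := hQ
  have hPe : ∀ x, P x ∈ eigenspace T χ := fun x => mem_eigenspace_of_tendsto (hP x) (hA0 x)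
  have hPid : ∀ x ∈ eigenspace T χ, P x = x := fun x hx =>
    tendsto_nhds_unique (hP x) (tendsto_const_nhds.congr fun i => (hAe i x hx).symm)
  refine isPole_iff.2 ⟨P, fun s => ?_, ?_, ?_, fun hap => ?_⟩
  · ext x
    refine tendsto_nhds_unique (hP (T s x)) ?_
    refine (((T s).continuous.tendsto _).comp (hP x)).congr fun i => ?_
    exact congrArg (fun R : E →L[ℂ] E => R x) (hAT i s).eq.symm
  · ext x
    exact hPid _ (hPe x)
  · refine le_antisymm ?_ fun x hx => ⟨x, hPid x hx⟩
    rintro _ ⟨x, rfl⟩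
    exact hPe x
  -- Unit approximate eigenvectors in `ker P` converge to a unit eigenvector `y`, for which `P y =
  -- y` and `P y = 0`.
  · choose x hxP hx1 hx using fun i : Finset S × ℕ =>
      hap.exists_norm_eq_one i.1 (Nat.one_div_pos_of_nat (α := ℝ) (n := i.2))
    have hx0 : ∀ s, Tendsto (fun i => T s (x i) - (χ s : ℂ) • x i) 𝒰 (𝓝 0) := by
      intro s
      rw [tendsto_zero_iff_norm_tendsto_zero]
      refine squeeze_zero' (Eventually.of_forall fun i => norm_nonneg _) ?_ hsmall
      filter_upwards [hmem s] with i hi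
      exact hx i s hi
    obtain ⟨y, hy⟩ := exists_tendsto_of_approx_eigenvectors hK hTK (χ a) 𝒰
      (Eventually.of_forall fun i => (hx1 i).le) (hx0 a)
    have hy1 : ‖y‖ = 1 := tendsto_nhds_unique hy.norm
      (tendsto_const_nhds.congr fun i => (hx1 i).symm)
    have hPy : P y = 0 := tendsto_nhds_unique ((P.continuous.tendsto y).comp hy)
      (tendsto_const_nhds.congr fun i => Eq.symm (hxP i))
    rw [hPid y (mem_eigenspace_of_tendsto hy hx0)] at hPy
    rw [hPy, norm_zero] at hy1
    exact zero_ne_one hy1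

end QuasiCompact
end SemigroupRep

theorem theorem3p11 {S : Type*} [AddCommMonoid S]
    {E : Type*} [NormedAddCommGroup E] [NormedSpace ℂ E] [CompleteSpace E]
    (T : SemigroupRep.Representation S (E →L[ℂ] E)) (hT : SemigroupRep.IsBounded T) :
    SemigroupRep.IsQuasiCompact T ↔
      ∀ χ ∈ SemigroupRep.unitarySpectrum T, SemigroupRep.IsRieszPoint T χ :=
  ⟨fun hq χ _ => ⟨SemigroupRep.isPole_of_isQuasiCompact hT hq χ,
    SemigroupRep.finiteDimensional_eigenspace hq χ⟩,
    SemigroupRep.isQuasiCompact_of_forall_isRieszPoint hT⟩
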